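/- Let $1\le S\le K$ and $d$ be integers and let $\Phi=(\varphi_1,\dots,\varphi_K)$ be a unit norm tight frame in $\mathbb R^d$, i.e. $\|\varphi_i\|_2=1$ for all $i$ and, for some $A>0$ (necessarily $A=K/d$), $\sum_{i=1}^K|\langle\varphi_i,v\rangle|^2=A\|v\|_2^2$ for all $v\in\mathbb R^d$. For a family $\Psi=(\psi_1,\dots,\psi_K)$ of vectors in $\mathbb R^d$ and $I\subseteq\{1,\dots,K\}$ let $P_I(\Psi)$ be the orthogonal projection of $\mathbb R^d$ onto $\operatorname{span}\{\psi_i:i\in I\}$, and write $\Phi x=\sum_i x(i)\varphi_i$ for $x\in\mathbb R^K$. Let $c\in\mathbb R^K$ with $c_1\ge c_2\ge\dots\ge c_K\ge 0$ and $\|c\|_2=1$. For a permutation $p$ of $\{1,\dots,K\}$ and a sign pattern $\sigma\in\{-1,1\}^K$ let $c_{p,\sigma}\in\mathbb R^K$ be given by $c_{p,\sigma}(i)=\sigma_i c_{p(i)}$, and let $x=c_{p,\sigma}$ with $(p,\sigma)$ uniformly distributed, i.e. each pair $(p,\sigma)$ has probability $(2^K K!)^{-1}$. Let $y=\Phi x$.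 Suppose that for all $p$ and $\sigma$, with $I_p:=p^{-1}(\{1,\dots,S\})$, $$\|P_{I_p}(\Phi)\Phi c_{p,\sigma}\|_2>\max_{|I|\le S,\ I\ne I_p}\|P_I(\Phi)\Phi c_{p,\sigma}\|_2 .$$ Then the function $$\Psi\mapsto\mathbb E_y\Big(\max_{|I|\le S}\|P_I(\Psi)y\|_2^2\Big)$$ on the set $\mathcal D$ of all families $\Psi=(\psi_1,\dots,\psi_K)$ of unit vectors in $\mathbb R^d$ has a local maximum at $\Phi$: there is $\varepsilon>0$ such that for every $\Psi\in\mathcal D$ with $\max_i\|\psi_i-\varphi_i\|_2<\varepsilon$ its value at $\Psi$ is at most its value at $\Phi$. -/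

import Mathlib

open scoped RealInnerProductSpace

noncomputable section

/-- A family of `K` vectors in Euclidean `ℝᵈ` (the columns of a `d × K` matrix). -/
abbrev AtomFamily (d K : ℕ) : Type := Fin K → EuclideanSpace ℝ (Fin d)

/-- The admissible dictionaries: all families of `K` atoms of unit norm. Distances between
dictionaries are measured by `max_i ‖ψ_i - φ_i‖`, the metric of the function space. -/
def dictionaries (d K : ℕ) : Set (AtomFamily d K) :=
  {Φ | ∀ i, ‖Φ i‖ = 1}

/-- Tight frame: `∑_i |⟨φ_i, v⟩|² = A ‖v‖²` for all `v`, for some constant `A > 0`. -/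
def IsTightFrame {d K : ℕ} (Φ : AtomFamily d K) : Prop :=
  ∃ A : ℝ, 0 < A ∧ ∀ v : EuclideanSpace ℝ (Fin d), ∑ i, |⟪Φ i, v⟫| ^ 2 = A * ‖v‖ ^ 2

/-- Synthesis `Φ x = ∑_i x(i) φ_i`. -/
def synth {d K : ℕ} (Φ : AtomFamily d K) (x : EuclideanSpace ℝ (Fin K)) :
    EuclideanSpace ℝ (Fin d) :=
  ∑ i, x i • Φ i

/-- `P_I(Φ)`: the orthogonal projection onto the span of the atoms indexed by `I`. -/
def atomProj {d K : ℕ} (Φ : AtomFamily d K) (I : Finset (Fin K)) :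
    EuclideanSpace ℝ (Fin d) →L[ℝ] EuclideanSpace ℝ (Fin d) :=
  (Submodule.span ℝ (Φ '' (I : Set (Fin K)))).starProjection

/-- `max_{|I| ≤ S} ‖P_I(Ψ) y‖²`. -/
def maxEnergy {d K : ℕ} (S : ℕ) (Ψ : AtomFamily d K) (y : EuclideanSpace ℝ (Fin d)) : ℝ :=
  (Finset.univ.filter fun I : Finset (Fin K) => I.card ≤ S).sup' ⟨∅, by simp⟩
    fun I => ‖atomProj Ψ I y‖ ^ 2

/-- The sequence `c_{p,σ}`, with `c_{p,σ}(i) = σ_i c_{p(i)}`; signs are the elements `±1` of `ℤˣ`. -/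
def signedPerm {K : ℕ} (c : EuclideanSpace ℝ (Fin K)) (p : Equiv.Perm (Fin K))
    (σ : Fin K → ℤˣ) : EuclideanSpace ℝ (Fin K) :=
  WithLp.toLp 2 fun i => ((σ i : ℤ) : ℝ) * c (p i)

/-- The law of the random coefficient vector `x = c_{p,σ}`, the pair `(p, σ)` being uniform among
the `2^K K!` pairs of a permutation and a sign pattern. -/
def coeffLaw {K : ℕ} (c : EuclideanSpace ℝ (Fin K)) : PMF (EuclideanSpace ℝ (Fin K)) :=
  (PMF.uniformOfFintype (Equiv.Perm (Fin K) × (Fin K → ℤˣ))).map fun q => signedPerm c q.1 q.2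

/-- The law of the random signal `y = Φ x`. -/
def signalLaw {d K : ℕ} (Φ : AtomFamily d K) (c : EuclideanSpace ℝ (Fin K)) :
    PMF (EuclideanSpace ℝ (Fin d)) :=
  (coeffLaw c).map (synth Φ)

/-- The criterion `Ψ ↦ E_y max_{|I| ≤ S} ‖P_I(Ψ) y‖²` for signals `y = Φ x`. -/
def expectedEnergy {d K : ℕ} (S : ℕ) (Φ : AtomFamily d K) (c : EuclideanSpace ℝ (Fin K))
    (Ψ : AtomFamily d K) : ℝ :=
  ∫ y, maxEnergy S Ψ y ∂(signalLaw Φ c).toMeasure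

/-- `I_p = p⁻¹({1, …, S})`, the positions of the `S` largest coefficients of `c_{p,σ}`; positions
are counted from `0`. -/
def topSet {K : ℕ} (S : ℕ) (p : Equiv.Perm (Fin K)) : Finset (Fin K) :=
  Finset.univ.filter fun i => (p i : ℕ) < S

end

open Filter Topology

/-! Strict maximality makes any `S` or fewer atoms of `Φ` independent, since dropping a redundant
atom would not change the projection. Hence each `‖P_I(Ψ) y‖` with `|I| ≤ S` is continuous in `Ψ` at
`Φ`. As only finitely many signals and sets occur, for `Ψ` near `Φ` the maximum is still attained at
`I_p`.

Averaging over signs kills the cross terms and leaves, up to a factor, `∑_p ∑_i c_{p(i)}²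
‖P_{I_p}(Ψ) φ_i‖²`. Let `D_j` be the drop in the coefficient of `c_j²` when `Φ` is replaced by `Ψ`.
For the top `S` indices `D_j ≥ 0`, because `P_I(Φ)` fixes the atoms in `I`; on the other indices `D`
is constant by symmetry; and `∑ D_j ≥ 0`, because tightness turns total energy into `A` times a
rank, which independence makes maximal for `Φ`. As `c_j²` decreases, `sum_antitone_mul_nonneg` gives
`∑ c_j² D_j ≥ 0`. -/

/-- If the weights `w` decrease, `D` is constant on the indices below `S` and on the others,
nonnegative on the former, and has nonnegative sum, then the weighted sum is nonnegative. -/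
lemma sum_antitone_mul_nonneg {K S : ℕ} (hS : 1 ≤ S) (hSK : S ≤ K) (w D : Fin K → ℝ)
    (hw : ∀ i j, i ≤ j → w j ≤ w i) (hw0 : ∀ i, 0 ≤ w i)
    (hlow : ∀ j : Fin K, (j : ℕ) < S → 0 ≤ D j)
    (hconst : ∀ i j : Fin K, S ≤ (i : ℕ) → S ≤ (j : ℕ) → D i = D j)
    (hsum : 0 ≤ ∑ j, D j) : 0 ≤ ∑ j, w j * D j := by
  by_cases h : ∃ i : Fin K, S ≤ (i : ℕ) ∧ D i < 0
  · obtain ⟨i, hi, hDi⟩ := h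
    -- The last index below `S` is where `D` changes sign, so replacing every weight by `w t` can
    -- only lower each term.
    let t : Fin K := ⟨S - 1, by omega⟩
    calc 0 ≤ w t * ∑ j, D j := mul_nonneg (hw0 t) hsum
      _ = ∑ j, w t * D j := Finset.mul_sum _ _ _
      _ ≤ ∑ j, w j * D j := by
        refine Finset.sum_le_sum fun j _ => ?_
        by_cases hj : (j : ℕ) < S
        · exact mul_le_mul_of_nonneg_right (hw j t (Fin.le_def.2 (Nat.le_sub_one_of_lt hj)))
            (hlow j hj)
        · refine mul_le_mul_of_nonpos_right (hw t j (Fin.le_def.2 ?_)) ?_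
          · change S - 1 ≤ (j : ℕ)
            omega
          · rw [hconst j i (not_lt.1 hj) hi]
            exact hDi.le
  · push Not at h
    refine Finset.sum_nonneg fun j _ => mul_nonneg (hw0 j) ?_
    by_cases hj : (j : ℕ) < S
    · exact hlow j hj
    · exact h j (not_lt.1 hj)

/-! ### Second moments: random signs and tight frames -/

/-- Independent signs are uncorrelated. -/
lemma sum_sign_mul_sign {ι : Type*} [Fintype ι] [DecidableEq ι] {i j : ι} (hij : i ≠ j) :
    ∑ σ : ι → ℤˣ, ((σ i : ℤ) : ℝ) * ((σ j : ℤ) : ℝ) = 0 := by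
  have h : ∑ σ : ι → ℤˣ, ((σ i : ℤ) : ℝ) * ((σ j : ℤ) : ℝ) =
      ∑ σ : ι → ℤˣ, -(((σ i : ℤ) : ℝ) * ((σ j : ℤ) : ℝ)) := by
    -- Flipping the sign at `i` alone permutes the sign patterns and negates the product.
    refine Fintype.sum_equiv (Equiv.mulLeft (Pi.mulSingle i (-1) : ι → ℤˣ)) _ _ fun σ => ?_
    simp [Pi.mulSingle_eq_of_ne hij.symm]
  rw [Finset.sum_neg_distrib] at h
  linarith

/-- The second moment of a random signed sum. -/
lemma sum_norm_sq_signed_sum {ι E : Type*} [Fintype ι] [DecidableEq ι] [NormedAddCommGroup E]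
    [InnerProductSpace ℝ E] (v : ι → E) :
    ∑ σ : ι → ℤˣ, ‖∑ i, ((σ i : ℤ) : ℝ) • v i‖ ^ 2 =
      Fintype.card (ι → ℤˣ) * ∑ i, ‖v i‖ ^ 2 := by
  have h (σ : ι → ℤˣ) : ‖∑ i, ((σ i : ℤ) : ℝ) • v i‖ ^ 2 =
      ∑ i, ∑ j, (((σ i : ℤ) : ℝ) * ((σ j : ℤ) : ℝ)) * ⟪v i, v j⟫ := by
    rw [← real_inner_self_eq_norm_sq, sum_inner]
    refine Finset.sum_congr rfl fun i _ => ?_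
    rw [inner_sum]
    refine Finset.sum_congr rfl fun j _ => ?_
    rw [real_inner_smul_left, real_inner_smul_right, mul_assoc]
  simp_rw [h]
  rw [Finset.sum_comm, Finset.mul_sum]
  refine Finset.sum_congr rfl fun i _ => ?_
  rw [Finset.sum_comm, Finset.sum_eq_single i]
  · have hs (σ : ι → ℤˣ) : ((σ i : ℤ) : ℝ) * ((σ i : ℤ) : ℝ) = 1 := by
      rcases Int.units_eq_one_or (σ i) with h | h <;> simp [h]
    simp [hs, Finset.card_univ]
  · intro j _ hj
    rw [← Finset.sum_mul, sum_sign_mul_sign hj.symm, zero_mul]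
  · simp

/-- For a tight frame with constant `A`, the projected energies sum to `A` times the dimension. -/
lemma sum_norm_sq_starProjection {ι E : Type*} [Fintype ι] [NormedAddCommGroup E]
    [InnerProductSpace ℝ E] [FiniteDimensional ℝ E] (f : ι → E) (A : ℝ)
    (hf : ∀ v, ∑ i, |⟪f i, v⟫| ^ 2 = A * ‖v‖ ^ 2) (U : Submodule ℝ E) :
    ∑ i, ‖U.starProjection (f i)‖ ^ 2 = A * Module.finrank ℝ U := by
  let b := stdOrthonormalBasis ℝ U
  have h (x : E) : ‖U.starProjection x‖ ^ 2 = ∑ k, |⟪x, (b k : E)⟫| ^ 2 := by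
    rw [Submodule.starProjection_apply, Submodule.norm_coe,
      ← b.sum_sq_norm_inner_right (U.orthogonalProjectionOnto x)]
    refine Finset.sum_congr rfl fun k _ => ?_
    rw [Submodule.inner_orthogonalProjectionOnto_eq_of_mem_left, real_inner_comm, Real.norm_eq_abs]
  simp_rw [h]
  rw [Finset.sum_comm]
  have hb (k) : ∑ i, |⟪f i, (b k : E)⟫| ^ 2 = A := by
    rw [hf, Submodule.norm_coe, b.norm_eq_one, one_pow, mul_one]
  rw [Finset.sum_congr rfl fun k _ => hb k]
  simp [mul_comm]

/-! ### Continuity of projections in the atoms -/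

/-- Synthesis with the atoms indexed by `I`, as a continuous linear map. -/
noncomputable def synthOn {d K : ℕ} (I : Finset (Fin K)) (Ψ : AtomFamily d K) :
    EuclideanSpace ℝ I →L[ℝ] EuclideanSpace ℝ (Fin d) :=
  ∑ i : I, (EuclideanSpace.proj i : EuclideanSpace ℝ I →L[ℝ] ℝ).smulRight (Ψ i)

lemma synthOn_apply {d K : ℕ} (I : Finset (Fin K)) (Ψ : AtomFamily d K)
    (a : EuclideanSpace ℝ I) : synthOn I Ψ a = ∑ i : I, a i • Ψ i := by
  simp [synthOn]

lemma continuous_synthOn {d K : ℕ} (I : Finset (Fin K)) :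
    Continuous (synthOn I : AtomFamily d K → _) := by
  refine continuous_finsetSum _ fun i _ => ?_
  exact ((ContinuousLinearMap.smulRightL ℝ (EuclideanSpace ℝ I) (EuclideanSpace ℝ (Fin d))
    (EuclideanSpace.proj i)).continuous).comp (continuous_apply (i : Fin K))

lemma mem_span_image_iff_synthOn {d K : ℕ} (I : Finset (Fin K)) (Ψ : AtomFamily d K)
    (v : EuclideanSpace ℝ (Fin d)) :
    v ∈ Submodule.span ℝ (Ψ '' (I : Set (Fin K))) ↔ ∃ a, synthOn I Ψ a = v := by
  have h : Ψ '' (I : Set (Fin K)) = Set.range fun i : I => Ψ i := by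
    rw [Set.image_eq_range]; rfl
  rw [h, Submodule.mem_span_range_iff_exists_fun]
  constructor
  · rintro ⟨a, ha⟩
    exact ⟨WithLp.toLp 2 a, by simpa [synthOn_apply] using ha⟩
  · rintro ⟨a, ha⟩
    exact ⟨fun i => a i, by simpa [synthOn_apply] using ha⟩

/-- The normal equations for the orthogonal projection. -/
lemma atomProj_eq_of_isUnit {d K : ℕ} (I : Finset (Fin K)) (Ψ : AtomFamily d K)
    (h : IsUnit ((synthOn I Ψ).adjoint ∘L synthOn I Ψ)) (y : EuclideanSpace ℝ (Fin d)) :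
    atomProj Ψ I y = synthOn I Ψ (Ring.inverse ((synthOn I Ψ).adjoint ∘L synthOn I Ψ)
      ((synthOn I Ψ).adjoint y)) := by
  set T := synthOn I Ψ with hT
  have hinv (z) : T.adjoint (T (Ring.inverse (T.adjoint ∘L T) z)) = z := by
    have := Ring.mul_inverse_cancel _ h
    exact congrArg (fun L : EuclideanSpace ℝ I →L[ℝ] EuclideanSpace ℝ I => L z) this
  refine (Submodule.eq_starProjection_of_mem_orthogonal
    ((mem_span_image_iff_synthOn I Ψ _).2 ⟨_, rfl⟩) ?_)
  rw [Submodule.mem_orthogonal]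
  intro u hu
  obtain ⟨a, rfl⟩ := (mem_span_image_iff_synthOn I Ψ u).1 hu
  rw [← hT, ← ContinuousLinearMap.adjoint_inner_right, map_sub, hinv, sub_self, inner_zero_right]

/-- Since `⟪T a, T a⟫ = ⟪a, T* T a⟫`, the Gram operator `T* T` is injective when `T` is; finite
dimension does the rest. -/
lemma isUnit_adjoint_comp_synthOn {d K : ℕ} (I : Finset (Fin K)) (Φ : AtomFamily d K)
    (h : LinearIndependent ℝ fun i : I => Φ i) :
    IsUnit ((synthOn I Φ).adjoint ∘L synthOn I Φ) := by
  have hinj : Function.Injective ((synthOn I Φ).adjoint ∘L synthOn I Φ) := by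
    rw [injective_iff_map_eq_zero]
    intro a ha
    have h0 : synthOn I Φ a = 0 := by
      rw [← inner_self_eq_zero (𝕜 := ℝ), ← ContinuousLinearMap.adjoint_inner_right]
      have : (synthOn I Φ).adjoint (synthOn I Φ a) = 0 := ha
      rw [this, inner_zero_right]
    rw [synthOn_apply] at h0
    ext i
    exact Fintype.linearIndependent_iff.1 h (fun i => a i) h0 i
  rw [ContinuousLinearMap.isUnit_iff_bijective]
  exact ⟨hinj, (LinearMap.injective_iff_surjective
    (f := ((synthOn I Φ).adjoint ∘L synthOn I Φ).toLinearMap)).1 hinj⟩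

/-- The projection onto the span of independent atoms depends continuously on the atoms. -/
lemma continuousAt_norm_atomProj {d K : ℕ} (I : Finset (Fin K)) (Φ : AtomFamily d K)
    (h : LinearIndependent ℝ fun i : I => Φ i) (y : EuclideanSpace ℝ (Fin d)) :
    ContinuousAt (fun Ψ : AtomFamily d K => ‖atomProj Ψ I y‖) Φ := by
  have hT := continuous_synthOn (d := d) I
  have hT' : Continuous fun Ψ : AtomFamily d K => (synthOn I Ψ).adjoint :=
    (ContinuousLinearMap.adjoint (𝕜 := ℝ) (E := EuclideanSpace ℝ I)
      (F := EuclideanSpace ℝ (Fin d))).continuous.comp hT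
  have hG : Continuous fun Ψ : AtomFamily d K => (synthOn I Ψ).adjoint ∘L synthOn I Ψ :=
    hT'.clm_comp hT
  have hunit := isUnit_adjoint_comp_synthOn I Φ h
  have hev : ∀ᶠ Ψ : AtomFamily d K in 𝓝 Φ, IsUnit ((synthOn I Ψ).adjoint ∘L synthOn I Ψ) :=
    hG.continuousAt.eventually (Units.isOpen.mem_nhds hunit)
  have hinv : ContinuousAt
      (fun Ψ : AtomFamily d K => Ring.inverse ((synthOn I Ψ).adjoint ∘L synthOn I Ψ)) Φ := by
    obtain ⟨u, hu⟩ := hunit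
    have := NormedRing.inverse_continuousAt u
    rw [hu] at this
    exact ContinuousAt.comp (f := fun Ψ : AtomFamily d K =>
      (synthOn I Ψ).adjoint ∘L synthOn I Ψ) this hG.continuousAt
  have hP : ContinuousAt (fun Ψ : AtomFamily d K =>
      ‖synthOn I Ψ (Ring.inverse ((synthOn I Ψ).adjoint ∘L synthOn I Ψ)
        ((synthOn I Ψ).adjoint y))‖) Φ :=
    (hT.continuousAt.clm_apply
      (hinv.clm_apply (hT'.continuousAt.clm_apply continuousAt_const))).norm
  refine hP.congr ?_
  filter_upwards [hev] with Ψ hΨ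
  rw [atomProj_eq_of_isUnit I Ψ hΨ y]

/-! ### Top sets and independence of the atoms -/

lemma mem_topSet {K S : ℕ} {p : Equiv.Perm (Fin K)} {i : Fin K} :
    i ∈ topSet S p ↔ (p i : ℕ) < S := by
  simp [topSet]

lemma exists_topSet_eq {K S : ℕ} (hSK : S ≤ K) (J : Finset (Fin K)) (hJ : J.card = S) :
    ∃ p : Equiv.Perm (Fin K), topSet S p = J := by
  have hcard : Fintype.card {i : Fin K // i ∈ J} = Fintype.card {k : Fin K // (k : ℕ) < S} := by
    rw [Fintype.card_coe, hJ, Fintype.card_subtype, Fin.card_filter_val_lt, min_eq_right hSK]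
  let e := Fintype.equivOfCardEq hcard
  refine ⟨e.extendSubtype, ?_⟩
  ext i
  rw [mem_topSet]
  refine ⟨fun h => ?_, fun h => e.extendSubtype_mem i h⟩
  by_contra hi
  exact e.extendSubtype_not_mem i hi h

lemma card_topSet_le {K : ℕ} (S : ℕ) (p : Equiv.Perm (Fin K)) : (topSet S p).card ≤ S := by
  have h : (topSet S p).card ≤ (Finset.univ.filter fun k : Fin K => (k : ℕ) < S).card :=
    Finset.card_le_card_of_injOn p (fun i hi => by simpa [topSet] using hi) p.injective.injOn
  rw [Fin.card_filter_val_lt] at h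
  omega

/-- If removing an atom from `topSet S p` always changes the projected signal, the atoms indexed
by at most `S` positions are linearly independent. -/
lemma linearIndependent_of_strict_max {d K S : ℕ} (hSK : S ≤ K) (Φ : AtomFamily d K)
    (c : EuclideanSpace ℝ (Fin K))
    (hmax : ∀ (p : Equiv.Perm (Fin K)) (σ : Fin K → ℤˣ) (I : Finset (Fin K)),
      I.card ≤ S → I ≠ topSet S p →
        ‖atomProj Φ I (synth Φ (signedPerm c p σ))‖ <
          ‖atomProj Φ (topSet S p) (synth Φ (signedPerm c p σ))‖)
    (I : Finset (Fin K)) (hI : I.card ≤ S) : LinearIndependent ℝ fun i : I => Φ i := by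
  -- Top sets have exactly `S` elements, so `I` is enlarged before the hypothesis can be applied.
  obtain ⟨J, hIJ, hJ⟩ := Finset.exists_superset_card_eq hI (by simpa using hSK)
  suffices hli : LinearIndepOn ℝ Φ (J : Set (Fin K)) from
    hli.mono (Finset.coe_subset.2 hIJ)
  rw [linearIndepOn_iff_notMem_span]
  intro i hi hmem
  obtain ⟨p, hp⟩ := exists_topSet_eq hSK J hJ
  have hlt := hmax p 1 (J.erase i) (by rw [← hJ]; exact Finset.card_le_card (J.erase_subset i))
    (by rw [hp]; exact fun h => Finset.notMem_erase i J (h.symm ▸ hi))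
  have hspan : Submodule.span ℝ (Φ '' (J : Set (Fin K))) =
      Submodule.span ℝ (Φ '' ((J.erase i : Finset (Fin K)) : Set (Fin K))) := by
    refine le_antisymm (Submodule.span_le.2 ?_) (Submodule.span_mono
      (Set.image_mono (Finset.coe_subset.2 (J.erase_subset i))))
    rintro _ ⟨j, hj, rfl⟩
    by_cases hji : j = i
    · subst hji
      simpa using hmem
    · exact Submodule.subset_span ⟨j, by simpa [hji] using hj, rfl⟩
  rw [hp] at hlt
  unfold atomProj at hlt
  simp only [hspan, lt_irrefl] at hlt

/-! ### Averages over signs and permutations -/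

/-- The expectation is the average over permutations and signs. -/
lemma expectedEnergy_eq_sum {d K : ℕ} (S : ℕ) (Φ : AtomFamily d K) (c : EuclideanSpace ℝ (Fin K))
    (Ψ : AtomFamily d K) :
    expectedEnergy S Φ c Ψ = (Fintype.card (Equiv.Perm (Fin K) × (Fin K → ℤˣ)) : ℝ)⁻¹ *
      ∑ p, ∑ σ, maxEnergy S Ψ (synth Φ (signedPerm c p σ)) := by
  let _ : MeasurableSpace (Equiv.Perm (Fin K) × (Fin K → ℤˣ)) := ⊤
  have hcont : Continuous (maxEnergy S Ψ) := by
    unfold maxEnergy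
    exact Continuous.finset_sup'_apply _ fun I _ => ((atomProj Ψ I).continuous.norm).pow 2
  have hlaw : signalLaw Φ c =
      (PMF.uniformOfFintype (Equiv.Perm (Fin K) × (Fin K → ℤˣ))).map
        fun q => synth Φ (signedPerm c q.1 q.2) := by
    rw [signalLaw, coeffLaw, PMF.map_comp]; rfl
  rw [expectedEnergy, hlaw, ← PMF.toMeasure_map _ _ measurable_from_top,
    MeasureTheory.integral_map measurable_from_top.aemeasurable
      hcont.aestronglyMeasurable, PMF.integral_eq_sum, ← Fintype.sum_prod_type', Finset.mul_sum]
  refine Finset.sum_congr rfl fun q _ => ?_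
  simp [PMF.uniformOfFintype_apply]

/-- Averaging over the signs the energy captured by a fixed projection. -/
lemma sum_sign_norm_sq_map_synth {d K : ℕ} (Φ : AtomFamily d K) (c : EuclideanSpace ℝ (Fin K))
    (p : Equiv.Perm (Fin K))
    (P : EuclideanSpace ℝ (Fin d) →L[ℝ] EuclideanSpace ℝ (Fin d)) :
    ∑ σ, ‖P (synth Φ (signedPerm c p σ))‖ ^ 2 =
      Fintype.card (Fin K → ℤˣ) * ∑ i, c (p i) ^ 2 * ‖P (Φ i)‖ ^ 2 := by
  have h := sum_norm_sq_signed_sum fun i => c (p i) • P (Φ i)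
  simp_rw [norm_smul, mul_pow, Real.norm_eq_abs, sq_abs] at h
  rw [← h]
  refine Finset.sum_congr rfl fun σ _ => ?_
  simp [synth, signedPerm, map_sum, mul_smul]

/-- Symmetrisation: a sum over permutations of a weighted sum depending on `p` only through
`topSet S p` has coefficients constant on the indices below `S` and on the others. -/
lemma sum_perm_topSet_congr {K S : ℕ} (h : Finset (Fin K) → Fin K → ℝ) (i j : Fin K)
    (hij : (i : ℕ) < S ↔ (j : ℕ) < S) :
    ∑ p : Equiv.Perm (Fin K), h (topSet S p) (p.symm i) =
      ∑ p : Equiv.Perm (Fin K), h (topSet S p) (p.symm j) := by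
  -- Swapping the values `i` and `j` of `p` keeps its top set, as both lie on the same side of `S`.
  refine Fintype.sum_equiv (Equiv.mulLeft (Equiv.swap i j)) _ _ fun p => ?_
  have htop : topSet S (Equiv.swap i j * p) = topSet S p := by
    ext k
    rw [mem_topSet, mem_topSet, Equiv.Perm.mul_apply]
    by_cases h1 : p k = i
    · rw [h1, Equiv.swap_apply_left, hij]
    · by_cases h2 : p k = j
      · rw [h2, Equiv.swap_apply_right, hij]
      · rw [Equiv.swap_apply_of_ne_of_ne h1 h2]
  have hsymm : (Equiv.swap i j * p).symm j = p.symm i := by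
    rw [Equiv.symm_apply_eq]
    simp
  simp only [Equiv.coe_mulLeft, htop, hsymm]

/-- Averaged over the permutations, no dictionary captures more energy than the generating one on
the positions of the largest coefficients. -/
lemma sum_perm_energy_le {d K S : ℕ} (hS : 1 ≤ S) (hSK : S ≤ K)
    (Φ Ψ : AtomFamily d K) (htight : IsTightFrame Φ)
    (hli : ∀ I : Finset (Fin K), I.card ≤ S → LinearIndependent ℝ fun i : I => Φ i)
    (c : EuclideanSpace ℝ (Fin K)) (hmono : ∀ i j : Fin K, i ≤ j → c j ≤ c i)
    (hnonneg : ∀ i, 0 ≤ c i) :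
    ∑ p : Equiv.Perm (Fin K), ∑ i, c (p i) ^ 2 * ‖atomProj Ψ (topSet S p) (Φ i)‖ ^ 2 ≤
      ∑ p : Equiv.Perm (Fin K), ∑ i, c (p i) ^ 2 * ‖atomProj Φ (topSet S p) (Φ i)‖ ^ 2 := by
  obtain ⟨A, hA, hframe⟩ := htight
  let h (I : Finset (Fin K)) (i : Fin K) : ℝ := ‖atomProj Φ I (Φ i)‖ ^ 2 - ‖atomProj Ψ I (Φ i)‖ ^ 2
  -- After the substitution `j = p i`, this is the coefficient of `c j ^ 2` in the difference of the
  -- two sides.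
  let D (j : Fin K) : ℝ := ∑ p : Equiv.Perm (Fin K), h (topSet S p) (p.symm j)
  have hrank (I : Finset (Fin K)) (hI : I.card ≤ S) : 0 ≤ ∑ i, h I i := by
    simp only [h, Finset.sum_sub_distrib, sub_nonneg, atomProj]
    rw [sum_norm_sq_starProjection Φ A hframe, sum_norm_sq_starProjection Φ A hframe]
    refine mul_le_mul_of_nonneg_left (Nat.cast_le.2 ?_) hA.le
    have himg (Θ : AtomFamily d K) : Θ '' (I : Set (Fin K)) = Set.range fun i : I => Θ i := by
      rw [Set.image_eq_range]; rfl
    rw [himg, himg, finrank_span_eq_card (hli I hI)]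
    exact finrank_range_le_card _
  have hlow (j : Fin K) (hj : (j : ℕ) < S) : 0 ≤ D j := by
    refine Finset.sum_nonneg fun p _ => ?_
    have hfix : atomProj Φ (topSet S p) (Φ (p.symm j)) = Φ (p.symm j) :=
      Submodule.starProjection_eq_self_iff.2
        (Submodule.subset_span ⟨p.symm j, by simpa [topSet] using hj, rfl⟩)
    simp only [h, hfix, sub_nonneg]
    gcongr
    exact Submodule.norm_starProjection_apply_le _ _
  have hconst (i j : Fin K) (hi : S ≤ (i : ℕ)) (hj : S ≤ (j : ℕ)) : D i = D j :=
    sum_perm_topSet_congr h i j (by omega)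
  have hsum : 0 ≤ ∑ j, D j := by
    rw [Finset.sum_comm]
    refine Finset.sum_nonneg fun p _ => ?_
    rw [Equiv.sum_comp p.symm]
    exact hrank _ (card_topSet_le S p)
  have key := sum_antitone_mul_nonneg hS hSK (fun j => c j ^ 2) D
    (fun i j hij => pow_le_pow_left₀ (hnonneg j) (hmono i j hij) 2) (fun i => sq_nonneg _)
    hlow hconst hsum
  rw [← sub_nonneg, ← Finset.sum_sub_distrib]
  convert key using 1
  simp only [D, Finset.mul_sum]
  rw [Finset.sum_comm]
  refine Finset.sum_congr rfl fun p _ => ?_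
  rw [← Finset.sum_sub_distrib, ← Equiv.sum_comp p.symm]
  refine Finset.sum_congr rfl fun j _ => ?_
  simp only [h, Equiv.apply_symm_apply]
  ring

/-! ### Local maximality -/

/-- Near `Φ` the maximal energy is captured by the positions of the largest coefficients. -/
lemma eventually_maxEnergy_le {d K S : ℕ} (Φ : AtomFamily d K)
    (hli : ∀ I : Finset (Fin K), I.card ≤ S → LinearIndependent ℝ fun i : I => Φ i)
    (J : Finset (Fin K)) (hJ : J.card ≤ S) (y : EuclideanSpace ℝ (Fin d))
    (hmax : ∀ I : Finset (Fin K), I.card ≤ S → I ≠ J → ‖atomProj Φ I y‖ < ‖atomProj Φ J y‖) :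
    ∀ᶠ Ψ in 𝓝 Φ, maxEnergy S Ψ y ≤ ‖atomProj Ψ J y‖ ^ 2 := by
  have hev : ∀ I : Finset (Fin K), ∀ᶠ Ψ : AtomFamily d K in 𝓝 Φ,
      I.card ≤ S → ‖atomProj Ψ I y‖ ≤ ‖atomProj Ψ J y‖ := by
    intro I
    by_cases hI : I.card ≤ S
    · by_cases hIJ : I = J
      · simp [hIJ]
      · filter_upwards [(continuousAt_norm_atomProj I Φ (hli I hI) y).eventually_lt
          (continuousAt_norm_atomProj J Φ (hli J hJ) y) (hmax I hI hIJ)] with Ψ hΨ _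
        exact hΨ.le
    · simp [hI]
  filter_upwards [eventually_all.2 hev] with Ψ hΨ
  refine Finset.sup'_le _ _ fun I hI => ?_
  exact pow_le_pow_left₀ (norm_nonneg _) (hΨ I (by simpa using hI)) 2

theorem mainTheorem5 (d K S : ℕ) (hS : 1 ≤ S) (hSK : S ≤ K)
    (Φ : AtomFamily d K) (hunit : Φ ∈ dictionaries d K) (htight : IsTightFrame Φ)
    (c : EuclideanSpace ℝ (Fin K)) (hmono : ∀ i j : Fin K, i ≤ j → c j ≤ c i)
    (hnonneg : ∀ i, 0 ≤ c i) (hnorm : ‖c‖ = 1)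
    (hmax : ∀ (p : Equiv.Perm (Fin K)) (σ : Fin K → ℤˣ) (I : Finset (Fin K)),
      I.card ≤ S → I ≠ topSet S p →
        ‖atomProj Φ I (synth Φ (signedPerm c p σ))‖ <
          ‖atomProj Φ (topSet S p) (synth Φ (signedPerm c p σ))‖) :
    IsLocalMaxOn (expectedEnergy S Φ c) (dictionaries d K) Φ := by
  have hli := linearIndependent_of_strict_max hSK Φ c hmax
  have hev : ∀ᶠ Ψ in 𝓝 Φ, ∀ (p : Equiv.Perm (Fin K)) (σ : Fin K → ℤˣ),
      maxEnergy S Ψ (synth Φ (signedPerm c p σ)) ≤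
        ‖atomProj Ψ (topSet S p) (synth Φ (signedPerm c p σ))‖ ^ 2 :=
    eventually_all.2 fun p => eventually_all.2 fun σ =>
      eventually_maxEnergy_le Φ hli _ (card_topSet_le S p) _ (hmax p σ)
  refine Filter.Eventually.filter_mono nhdsWithin_le_nhds ?_
  filter_upwards [hev] with Ψ hΨ
  rw [expectedEnergy_eq_sum, expectedEnergy_eq_sum]
  refine mul_le_mul_of_nonneg_left ?_ (by positivity)
  calc ∑ p, ∑ σ, maxEnergy S Ψ (synth Φ (signedPerm c p σ))
      ≤ ∑ p, ∑ σ, ‖atomProj Ψ (topSet S p) (synth Φ (signedPerm c p σ))‖ ^ 2 :=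
        Finset.sum_le_sum fun p _ => Finset.sum_le_sum fun σ _ => hΨ p σ
    _ ≤ ∑ p, ∑ σ, ‖atomProj Φ (topSet S p) (synth Φ (signedPerm c p σ))‖ ^ 2 := by
        simp_rw [sum_sign_norm_sq_map_synth, ← Finset.mul_sum]
        exact mul_le_mul_of_nonneg_left
          (sum_perm_energy_le hS hSK Φ Ψ htight hli c hmono hnonneg) (by positivity)
    _ ≤ ∑ p, ∑ σ, maxEnergy S Φ (synth Φ (signedPerm c p σ)) := by
        refine Finset.sum_le_sum fun p _ => Finset.sum_le_sum fun σ _ => ?_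
        exact Finset.le_sup' (fun I => ‖atomProj Φ I (synth Φ (signedPerm c p σ))‖ ^ 2)
          (by simpa using card_topSet_le S p)
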